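/- Cascading bandits. Let $L,K$ be positive integers with $K\le L$. An action is an ordered list $A=(a_1,\dots,a_K)$ of $K$ distinct items of $[L]=\{1,\dots,L\}$. For an instance $\bar w\in[0,1]^L$ let $\mathbf w_t(e)$ ($t\ge 1$, $e\in[L]$) be independent random variables, $\mathbf w_t(e)$ being Bernoulli with mean $\bar w(e)$. In each round $t=1,2,\dots$ the learner chooses an action $\mathbf A_t=(\mathbf a^t_1,\dots,\mathbf a^t_K)$, the user clicks on the first attractive item of the list, at position $\mathbf C_t=\inf\{k\in[K]:\mathbf w_t(\mathbf a^t_k)=1\}$ (with $\inf\emptyset=\infty$), and the learner observes $\mathbf w_t(\mathbf a^t_k)$ exactly for the examined positions $k\le\min\{\mathbf C_t,K\}$. A policy $\pi\in\Pi$ is a mapping from the history (the actions and observations of all earlier rounds) to the current action. With $A^*=(a_1^*,\dots,a_K^*)$ any action that maximizes the click probability $1-\prod_{k=1}^K(1-\bar w(a_k))$, the regret of $\pi$ on $\bar w$ with horizon $n$ is \[ R_{\pi,\bar w}(n)=\mathbb E_{\pi,\bar w}\Big[\sum_{t=1}^n\Big(\prod_{k=1}^K(1-\bar w(\mathbf a^t_k))-\prod_{k=1}^K(1-\bar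 w(a^*_k))\Big)\Big]. \] Theorem. If $N=L/K$ is an integer with $N\ge 4$, and $n\ge L$ is an integer, then the minimum below is attained and \[ \min_{\pi\in\Pi}\ \sup_{\bar w\in[0,1]^L} R_{\pi,\bar w}(n)\ \ge\ \frac{1}{160}\sqrt{nL}. \] -/

import Mathlib

open MeasureTheory ProbabilityTheory

noncomputable section

namespace CascadingBandit

/-- An action: an ordered list of `K` distinct items out of `L`. -/
abbrev Action (L K : ℕ) : Type := Fin K ↪ Fin L

/-- What the learner sees in one round: position `k` of the list carries `some b` if it was
examined and `b` says whether the item there was attractive, and `none` if it was not examined. -/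
abbrev Feedback (K : ℕ) : Type := Fin K → Option Bool

/-- A history: the list of all past rounds, oldest first, with the action and the feedback. -/
abbrev History (L K : ℕ) : Type := List (Action L K × Feedback K)

/-- A policy maps the history before a round to the action of that round. (The index of the round
is the length of the history.) -/
abbrev Policy (L K : ℕ) : Type := History L K → Action L K

/-- The position (counted from 1) of the first attractive item of the list `A`, when `x e` says
whether item `e` is attractive; it is `⊤` (infinity) if no item of the list is attractive. -/
def firstClick {L K : ℕ} (x : Fin L → Bool) (A : Action L K) : ℕ∞ :=
  sInf {c : ℕ∞ | ∃ k : Fin K, x (A k) = true ∧ c = (((k : ℕ) + 1 : ℕ) : ℕ∞)}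

open Classical in
/-- The learner observes the realizations at the positions up to and including the click
(at all positions if there is no click). -/
def feedback {L K : ℕ} (x : Fin L → Bool) (A : Action L K) : Feedback K :=
  fun k => if (((k : ℕ) + 1 : ℕ) : ℕ∞) ≤ firstClick x A then some (x (A k)) else none

/-- The history before round `t` (rounds are numbered `0, 1, 2, …`), when the policy `π` is played
and `ω s e` says whether item `e` is attractive in round `s`. -/
def history {L K : ℕ} (π : Policy L K) (ω : ℕ → Fin L → Bool) : ℕ → History L K
  | 0 => []
  | t + 1 =>
      history π ω t ++ [(π (history π ω t), feedback (ω t) (π (history π ω t)))]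

/-- The action that the policy `π` plays in round `t`. -/
def action {L K : ℕ} (π : Policy L K) (ω : ℕ → Fin L → Bool) (t : ℕ) : Action L K :=
  π (history π ω t)

/-- The law of the attraction variables: they are independent over all rounds and items, and the
one of item `e` is Bernoulli with parameter `w e` in every round. -/
def law {L : ℕ} (w : Fin L → unitInterval) : Measure (ℕ → Fin L → Bool) :=
  Measure.infinitePi fun _ : ℕ => Measure.pi fun e : Fin L => bernoulliMeasure true false (w e)

/-- The probability that the list `A` receives no click. -/
def noClickProb {L K : ℕ} (w : Fin L → unitInterval) (A : Action L K) : ℝ :=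
  ∏ k : Fin K, (1 - (w (A k) : ℝ))

/-- The no-click probability of an optimal action. -/
def optNoClickProb {L : ℕ} (K : ℕ) (w : Fin L → unitInterval) : ℝ :=
  ⨅ A : Action L K, noClickProb w A

/-- `optNoClickProb` is the no-click probability of any action with maximal click probability. -/
theorem optNoClickProb_eq {L K : ℕ} (w : Fin L → unitInterval) (A : Action L K)
    (hA : ∀ B : Action L K, 1 - noClickProb w B ≤ 1 - noClickProb w A) :
    optNoClickProb K w = noClickProb w A := by
  have : Nonempty (Action L K) := ⟨A⟩
  refine le_antisymm (ciInf_le (Set.finite_range _).bddBelow A) (le_ciInf fun B => ?_)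
  have := hA B
  linarith

/-- The expected cumulative regret of the policy `π` on the instance `w` after `n` rounds. -/
def regret {L K : ℕ} (π : Policy L K) (w : Fin L → unitInterval) (n : ℕ) : ℝ :=
  ∫ ω, ∑ t ∈ Finset.range n, (noClickProb w (action π ω t) - optNoClickProb K w) ∂(law w)

/-- `r` is the worst-case regret of `π`: the supremum of its regret over all instances. -/
def IsWorstCaseRegret {L K : ℕ} (π : Policy L K) (n : ℕ) (r : ℝ) : Prop :=
  IsLUB (Set.range fun w : Fin L → unitInterval => regret π w n) r

/-- `r` is the minimax regret: the minimum over all policies of the worst-case regret. -/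
def IsMinimaxRegret (L K n : ℕ) (r : ℝ) : Prop :=
  IsLeast {s : ℝ | ∃ π : Policy L K, IsWorstCaseRegret π n s} r

end CascadingBandit

end

noncomputable section

namespace CascadingBandit

/-! The hard instances give mean `q = 1/(2K)` to a set `S` of `K` good items and `q - δ` to the
rest, with `δ = √(L/n)/(8K)`. Since `(1 - q)^j ≥ 1/2` for `j < K`, every bad item in a list costs
regret at least `δ/2`. It suffices to find, for each policy, an `S` whose items fill at most two
thirds of the `nK` listed slots.

Compare `S` with `S \ {e}`. The two instances differ only at `e`, so a round carries information
about the difference only if `e` is listed, and then at most `d = δ²/(q(1-q))`, a χ² bound on the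
divergence. The information is thus proportional to the expected number of listings of `e` under `S
\ {e}`, and a Donsker-Varadhan argument shows that adding `e` to the good set multiplies its
expected listings by at most `C = 4/3 (1 + 2nd)` (`expectedPulls_le_mul`).

Summed over all `S` and `e ∈ S`, this bounds the listings of good items by `C` times those of items
outside a `(K-1)`-set, at most `nK` per set. There are `K/(L-K+1)` times as many `(K-1)`-sets as
`K`-sets, so some `S` gets at most `C K/(L-K+1) · nK ≤ 2/3 · nK`.

The minimum is attained because up to the horizon only finitely many policies are distinguishable.
-/

/-! ### Expectations over histories as iterated finite sums -/

/-- The probability of the realization `x` of the attraction variables of one round. -/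
def roundWeight {L : ℕ} (w : Fin L → unitInterval) (x : Fin L → Bool) : ℝ :=
  ∏ e, if x e then (w e : ℝ) else 1 - w e

/-- The conditional expectation of `F` of the next history given the present one. -/
def expectedStep {L K : ℕ} (π : Policy L K) (w : Fin L → unitInterval) (F : History L K → ℝ)
    (h : History L K) : ℝ :=
  ∑ x, roundWeight w x * F (h ++ [(π h, feedback x (π h))])

instance {L : ℕ} (w : Fin L → unitInterval) : IsProbabilityMeasure (law w) := by
  unfold law; infer_instance

theorem history_congr {L K : ℕ} (π : Policy L K) {ω ω' : ℕ → Fin L → Bool} {t : ℕ}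
    (h : ∀ s < t, ω s = ω' s) : history π ω t = history π ω' t := by
  induction t with
  | zero => rfl
  | succ t ih =>
    simp only [history]
    rw [ih fun s hs => h s (by omega), h t (by omega)]

theorem history_length {L K : ℕ} (π : Policy L K) (ω : ℕ → Fin L → Bool) (t : ℕ) :
    (history π ω t).length = t := by
  induction t with
  | zero => rfl
  | succ t ih => simp [history, ih]

/-- A sequence with prescribed values at the indices below `t`. -/
def extendPrefix {X : Type*} [Inhabited X] (t : ℕ) (r : Finset.range t → X) : ℕ → X :=
  fun i => if h : i ∈ Finset.range t then r ⟨i, h⟩ else default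

theorem history_extendPrefix {L K : ℕ} (π : Policy L K) (ω : ℕ → Fin L → Bool) (t : ℕ) :
    history π (extendPrefix t fun i : Finset.range t => ω i) t = history π ω t :=
  history_congr π fun s hs => by simp [extendPrefix, hs]

/-- The history before round `t` factors through the first `t` rounds, which take finitely many
values. -/
theorem integrable_history {L K : ℕ} (π : Policy L K) (w : Fin L → unitInterval)
    (F : History L K → ℝ) (t : ℕ) : Integrable (fun ω => F (history π ω t)) (law w) := by
  have hm : Measurable fun (ω : ℕ → Fin L → Bool) (i : Finset.range t) => ω i := by fun_prop
  have h := (Integrable.of_finite (μ := (law w).map fun ω (i : Finset.range t) => ω i)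
    (f := fun r => F (history π (extendPrefix t r) t))).comp_measurable hm
  simpa [Function.comp_def, history_extendPrefix] using h

theorem integral_pi_bernoulli {L : ℕ} (w : Fin L → unitInterval) (f : (Fin L → Bool) → ℝ) :
    ∫ x, f x ∂(Measure.pi fun e => bernoulliMeasure true false (w e)) =
      ∑ x, roundWeight w x * f x := by
  rw [integral_fintype .of_finite]
  refine Finset.sum_congr rfl fun x _ => ?_
  rw [smul_eq_mul, measureReal_def, Measure.pi_singleton, ENNReal.toReal_prod]
  congr 1
  refine Finset.prod_congr rfl fun e _ => ?_
  rw [← measureReal_def]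
  cases x e <;> simp

theorem indepFun_prefix {L : ℕ} (w : Fin L → unitInterval) (t : ℕ) :
    IndepFun (fun (ω : ℕ → Fin L → Bool) (i : Finset.range t) => ω i) (fun ω => ω t) (law w) := by
  have h := (iIndepFun_infinitePi (X := fun (_ : ℕ) (x : Fin L → Bool) => x)
    (P := fun _ : ℕ => Measure.pi fun e : Fin L => bernoulliMeasure true false (w e))
    fun _ => measurable_id).indepFun_finset (Finset.range t) {t} (by simp)
    fun _ => by fun_prop
  exact h.comp measurable_id
    (measurable_pi_apply (⟨t, by simp⟩ : ({t} : Finset ℕ)))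

/-- The past is independent of round `t`, so Fubini integrates that round out first. -/
theorem integral_history_succ {L K : ℕ} (π : Policy L K) (w : Fin L → unitInterval)
    (F : History L K → ℝ) (t : ℕ) :
    ∫ ω, F (history π ω (t + 1)) ∂(law w) =
      ∫ ω, expectedStep π w F (history π ω t) ∂(law w) := by
  let ρ : (ℕ → Fin L → Bool) → Finset.range t → Fin L → Bool := fun ω i => ω i
  let H : (Finset.range t → Fin L → Bool) → History L K := fun r => history π (extendPrefix t r) t
  let G : (Finset.range t → Fin L → Bool) × (Fin L → Bool) → ℝ := fun z =>
    F (H z.1 ++ [(π (H z.1), feedback z.2 (π (H z.1)))])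
  have hρ : Measurable ρ := by fun_prop
  have ht : Measurable fun ω : ℕ → Fin L → Bool => ω t := by fun_prop
  have hprod := (indepFun_prefix w t).map_prod_eq_prod_map_map hρ.aemeasurable ht.aemeasurable
  have heval : (law w).map (fun ω => ω t) =
      Measure.pi fun e => bernoulliMeasure true false (w e) :=
    Measure.infinitePi_map_eval _ t
  have hH : ∀ ω, H (ρ ω) = history π ω t := fun ω => history_extendPrefix π ω t
  calc ∫ ω, F (history π ω (t + 1)) ∂(law w)
      = ∫ ω, G (ρ ω, ω t) ∂(law w) := by simp only [G, hH, history]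
    _ = ∫ z, G z ∂((law w).map fun ω => (ρ ω, ω t)) :=
        (integral_map (hρ.prodMk ht).aemeasurable
          (Measurable.of_discrete.aestronglyMeasurable)).symm
    _ = ∫ r, ∫ x, G (r, x) ∂(Measure.pi fun e => bernoulliMeasure true false (w e))
          ∂((law w).map ρ) := by
        rw [hprod, heval]
        have : IsProbabilityMeasure ((law w).map ρ) :=
          Measure.isProbabilityMeasure_map hρ.aemeasurable
        exact integral_prod _ .of_finite
    _ = ∫ ω, expectedStep π w F (history π ω t) ∂(law w) := by
        rw [integral_map hρ.aemeasurable (Measurable.of_discrete.aestronglyMeasurable)]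
        refine integral_congr_ae (.of_forall fun ω => ?_)
        simp only [integral_pi_bernoulli, G, hH, expectedStep]

theorem integral_history {L K : ℕ} (π : Policy L K) (w : Fin L → unitInterval)
    (F : History L K → ℝ) (t : ℕ) :
    ∫ ω, F (history π ω t) ∂(law w) = (expectedStep π w)^[t] F [] := by
  induction t generalizing F with
  | zero => simp [history]
  | succ t ih => rw [integral_history_succ, ih, Function.iterate_succ_apply]

/-! ### Change of measure in one round -/

theorem roundWeight_nonneg {L : ℕ} (w : Fin L → unitInterval) (x : Fin L → Bool) :
    0 ≤ roundWeight w x :=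
  Finset.prod_nonneg fun e _ => by
    split_ifs
    · exact (w e).2.1
    · exact sub_nonneg.2 (w e).2.2

theorem sum_roundWeight_mul_coord {L : ℕ} (w : Fin L → unitInterval) (e : Fin L)
    (g : Bool → ℝ) :
    ∑ x, roundWeight w x * g (x e) = w e * g true + (1 - w e) * g false := by
  let f : Fin L → Bool → ℝ := fun i b =>
    (if b then (w i : ℝ) else 1 - w i) * if i = e then g b else 1
  have hf : ∀ x : Fin L → Bool, roundWeight w x * g (x e) = ∏ i, f i (x i) := fun x => by
    simp only [f, roundWeight, Finset.prod_mul_distrib, Finset.prod_ite_eq', Finset.mem_univ,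
      if_true]
  simp only [hf]
  rw [← Fintype.piFinset_univ, ← Finset.prod_univ_sum, Fintype.prod_eq_single e]
  · simp [f]
  · intro i hi
    simp [f, hi]

theorem sum_roundWeight {L : ℕ} (w : Fin L → unitInterval) : ∑ x, roundWeight w x = 1 := by
  simpa using (integral_pi_bernoulli w fun _ => 1).symm

theorem roundWeight_eq_mul_prod_erase {L : ℕ} (w : Fin L → unitInterval) (x : Fin L → Bool)
    (e : Fin L) :
    roundWeight w x = (if x e then (w e : ℝ) else 1 - w e) *
      ∏ i ∈ Finset.univ.erase e, if x i then (w i : ℝ) else 1 - w i :=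
  (Finset.mul_prod_erase _ _ (Finset.mem_univ e)).symm

/-- Flipping one coordinate, as an involution. -/
def flipAt {L : ℕ} (e : Fin L) : Equiv.Perm (Fin L → Bool) :=
  Function.Involutive.toPerm (fun x => Function.update x e (!x e)) fun x => by simp

theorem flipAt_apply {L : ℕ} (e : Fin L) (x : Fin L → Bool) :
    flipAt e x = Function.update x e (!x e) := rfl

theorem roundWeight_add_flipAt {L : ℕ} (w : Fin L → unitInterval) (x : Fin L → Bool)
    (e : Fin L) :
    roundWeight w x + roundWeight w (flipAt e x) =
      ∏ i ∈ Finset.univ.erase e, if x i then (w i : ℝ) else 1 - w i := by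
  rw [roundWeight_eq_mul_prod_erase w x e, roundWeight_eq_mul_prod_erase w (flipAt e x) e]
  have : ∏ i ∈ Finset.univ.erase e, (if flipAt e x i then (w i : ℝ) else 1 - w i) =
      ∏ i ∈ Finset.univ.erase e, if x i then (w i : ℝ) else 1 - w i :=
    Finset.prod_congr rfl fun i hi => by
      simp [flipAt_apply, Function.update_of_ne (Finset.ne_of_mem_erase hi)]
  rw [this, ← add_mul]
  cases h : x e <;> simp [flipAt_apply, h]

/-- Pairing `x` with its flip at `e` cancels the parameter `w e`: the right side no longer involves
it. -/
theorem two_mul_sum_roundWeight_mul {L : ℕ} (w : Fin L → unitInterval) (e : Fin L)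
    (y : (Fin L → Bool) → ℝ) (hy : ∀ x b, y (Function.update x e b) = y x) :
    2 * ∑ x, roundWeight w x * y x =
      ∑ x, (∏ i ∈ Finset.univ.erase e, if x i then (w i : ℝ) else 1 - w i) * y x := by
  simp only [← roundWeight_add_flipAt, add_mul, Finset.sum_add_distrib, two_mul]
  congr 1
  rw [← Equiv.sum_comp (flipAt e)]
  exact Finset.sum_congr rfl fun x _ => by rw [show y (flipAt e x) = y x from hy x _]

theorem sum_roundWeight_mul_congr {L : ℕ} {w w' : Fin L → unitInterval} {e : Fin L}
    (hw : ∀ i, i ≠ e → w i = w' i) (y : (Fin L → Bool) → ℝ)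
    (hy : ∀ x b, y (Function.update x e b) = y x) :
    ∑ x, roundWeight w x * y x = ∑ x, roundWeight w' x * y x := by
  have h : 2 * ∑ x, roundWeight w x * y x = 2 * ∑ x, roundWeight w' x * y x := by
    rw [two_mul_sum_roundWeight_mul w e y hy, two_mul_sum_roundWeight_mul w' e y hy]
    refine Finset.sum_congr rfl fun x _ => ?_
    congr 1
    exact Finset.prod_congr rfl fun i hi => by rw [hw i (Finset.ne_of_mem_erase hi)]
  linarith

theorem feedback_update {L K : ℕ} (x : Fin L → Bool) (A : Action L K) {e : Fin L}
    (he : e ∉ Set.range A) (b : Bool) :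
    feedback (Function.update x e b) A = feedback x A := by
  have h : ∀ k, Function.update x e b (A k) = x (A k) := fun k =>
    Function.update_of_ne (fun h => he ⟨k, h⟩) _ _
  unfold feedback firstClick
  simp only [h]

theorem exp_neg_sum_roundWeight_le {L : ℕ} (w : Fin L → unitInterval)
    (u : (Fin L → Bool) → ℝ) :
    Real.exp (-∑ x, roundWeight w x * u x) ≤ ∑ x, roundWeight w x * Real.exp (-u x) := by
  have h := convexOn_exp.map_sum_le (t := Finset.univ) (w := roundWeight w)
    (p := fun x => -u x) (fun x _ => roundWeight_nonneg w x) (sum_roundWeight w)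
    (fun _ _ => Set.mem_univ _)
  simpa using h

/-- The Kullback-Leibler divergence of Bernoulli laws is at most their `χ²`-divergence. -/
theorem bernoulli_kl_le {p q : ℝ} (hp0 : 0 < p) (hp1 : p < 1) (hq0 : 0 < q) (hq1 : q < 1) :
    -((q - p) ^ 2 / (q * (1 - q))) ≤
      p * Real.log (q / p) + (1 - p) * Real.log ((1 - q) / (1 - p)) := by
  have hp1' : 0 < 1 - p := by linarith
  have hq1' : 0 < 1 - q := by linarith
  have h1 := Real.one_sub_inv_le_log_of_pos (div_pos hq0 hp0)
  have h2 := Real.one_sub_inv_le_log_of_pos (div_pos hq1' hp1')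
  have h3 := mul_le_mul_of_nonneg_left h1 hp0.le
  have h4 := mul_le_mul_of_nonneg_left h2 hp1'.le
  refine le_trans (le_of_eq ?_) (add_le_add h3 h4)
  field_simp
  ring

theorem roundWeight_eq_mul_ratio {L : ℕ} {w w' : Fin L → unitInterval} {e : Fin L}
    (hw : ∀ i, i ≠ e → w i = w' i) (h0 : 0 < (w e : ℝ)) (h1 : (w e : ℝ) < 1)
    (x : Fin L → Bool) :
    roundWeight w' x = roundWeight w x *
      if x e then (w' e / w e : ℝ) else (1 - w' e) / (1 - w e) := by
  have h1' : (1 - w e : ℝ) ≠ 0 := by linarith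
  rw [roundWeight_eq_mul_prod_erase w x e, roundWeight_eq_mul_prod_erase w' x e,
    Finset.prod_congr rfl fun i hi => by rw [← hw i (Finset.ne_of_mem_erase hi)]]
  split_ifs <;> field_simp

/-- The cost of a change of measure in one round. -/
theorem exp_neg_sum_roundWeight_le_of_ratio {L : ℕ} {w w' : Fin L → unitInterval} {e : Fin L}
    (hw : ∀ i, i ≠ e → w i = w' i) (h0 : 0 < (w e : ℝ)) (h1 : (w e : ℝ) < 1)
    (h0' : 0 < (w' e : ℝ)) (h1' : (w' e : ℝ) < 1) (u : (Fin L → Bool) → ℝ) :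
    Real.exp (-∑ x, roundWeight w x * u x) ≤
      Real.exp ((w' e - w e : ℝ) ^ 2 / (w' e * (1 - w' e))) *
        ∑ x, roundWeight w' x * Real.exp (-u x) := by
  let ρ : Bool → ℝ := fun b => if b then (w' e / w e : ℝ) else (1 - w' e) / (1 - w e)
  have hρ : ∀ b, 0 < ρ b := fun b => by
    have := sub_pos.2 h1
    have := sub_pos.2 h1'
    cases b <;> simp only [ρ] <;> simp <;> positivity
  have hkl := bernoulli_kl_le h0 h1 h0' h1'
  have hsum : ∑ x, roundWeight w x * Real.log (ρ (x e)) =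
      w e * Real.log (w' e / w e) + (1 - w e) * Real.log ((1 - w' e) / (1 - w e)) := by
    simpa [ρ] using sum_roundWeight_mul_coord w e fun b => Real.log (ρ b)
  -- Jensen under `w` for `u` minus the log-likelihood ratio: the ratio turns `w` into `w'` on the
  -- right and leaves the divergence on the left.
  have hj := exp_neg_sum_roundWeight_le w fun x => u x - Real.log (ρ (x e))
  have hx : ∀ x, roundWeight w x * Real.exp (-(u x - Real.log (ρ (x e)))) =
      roundWeight w' x * Real.exp (-u x) := fun x => by
    rw [roundWeight_eq_mul_ratio hw h0 h1 x, neg_sub, sub_eq_add_neg, Real.exp_add,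
      Real.exp_log (hρ _), mul_assoc]
  simp only [hx, mul_sub, Finset.sum_sub_distrib, hsum] at hj
  refine le_trans ?_ (mul_le_mul_of_nonneg_left hj (Real.exp_pos _).le)
  rw [← Real.exp_add]
  apply Real.exp_le_exp.2
  linarith

/-! ### Listing counts and change of measure over all rounds -/

open Classical in
/-- The number of rounds in which item `e` was listed. -/
def pulls {L K : ℕ} (e : Fin L) (h : History L K) : ℝ :=
  (h.map fun r => if e ∈ Set.range r.1 then (1 : ℝ) else 0).sum

open Classical in
theorem pulls_append {L K : ℕ} (e : Fin L) (h : History L K) (r : Action L K × Feedback K) :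
    pulls e (h ++ [r]) = pulls e h + if e ∈ Set.range r.1 then 1 else 0 := by
  simp [pulls]

theorem pulls_nonneg {L K : ℕ} (e : Fin L) (h : History L K) : 0 ≤ pulls e h :=
  List.sum_nonneg fun x hx => by
    obtain ⟨r, -, rfl⟩ := List.mem_map.1 hx
    split_ifs <;> simp

theorem pulls_le_length {L K : ℕ} (e : Fin L) (h : History L K) : pulls e h ≤ h.length := by
  induction h with
  | nil => simp [pulls]
  | cons r h ih =>
    simp only [pulls, List.map_cons, List.sum_cons, List.length_cons, Nat.cast_succ] at ih ⊢
    split_ifs <;> linarith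

/-- A form of the Donsker-Varadhan inequality: only the rounds in which the item `e` is listed
distinguish two instances that differ at `e`. -/
theorem exp_neg_expectedStep_iterate_le {L K : ℕ} (π : Policy L K)
    {w w' : Fin L → unitInterval} {e : Fin L} (hw : ∀ i, i ≠ e → w i = w' i)
    (h0 : 0 < (w e : ℝ)) (h1 : (w e : ℝ) < 1) (h0' : 0 < (w' e : ℝ)) (h1' : (w' e : ℝ) < 1)
    {d : ℝ} (hd : d = (w' e - w e : ℝ) ^ 2 / (w' e * (1 - w' e))) (c : ℝ) (m : ℕ)
    (h : History L K) :
    Real.exp (-(expectedStep π w)^[m] (fun h => (c + d) * pulls e h) h) ≤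
      Real.exp (-(d * pulls e h)) *
        (expectedStep π w')^[m] (fun h => Real.exp (-(c * pulls e h))) h := by
  induction m generalizing h with
  | zero =>
    simp only [Function.iterate_zero, id_eq, ← Real.exp_add]
    exact Real.exp_le_exp.2 (le_of_eq (by ring))
  | succ m ih =>
    simp only [Function.iterate_succ_apply']
    set F := (expectedStep π w)^[m] fun h => (c + d) * pulls e h
    set G := (expectedStep π w')^[m] fun h => Real.exp (-(c * pulls e h))
    simp only [expectedStep]
    by_cases he : e ∈ Set.range (π h)
    -- Item listed: the factor `exp d` paid here is cancelled by the unit increase of `pulls e` in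
    -- `exp (-d * pulls)`.
    · refine (exp_neg_sum_roundWeight_le_of_ratio hw h0 h1 h0' h1' _).trans ?_
      rw [← hd, Finset.mul_sum, Finset.mul_sum]
      refine Finset.sum_le_sum fun x _ => ?_
      have := ih (h ++ [(π h, feedback x (π h))])
      rw [pulls_append, if_pos he] at this
      calc _ = roundWeight w' x * (Real.exp d *
            Real.exp (-F (h ++ [(π h, feedback x (π h))]))) := by ring
        _ ≤ roundWeight w' x * (Real.exp d * (Real.exp (-(d * (pulls e h + 1))) *
            G (h ++ [(π h, feedback x (π h))]))) := by
          gcongr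
          exact roundWeight_nonneg _ _
        _ = _ := by
          rw [← mul_assoc (Real.exp d), ← Real.exp_add]
          ring_nf
    -- Item not listed: the feedback ignores coordinate `e`, so after Jensen `w` is replaced by `w'`
    -- for free.
    · refine (exp_neg_sum_roundWeight_le w _).trans ?_
      rw [sum_roundWeight_mul_congr hw _ fun x b => by rw [feedback_update _ _ he],
        Finset.mul_sum]
      refine Finset.sum_le_sum fun x _ => ?_
      have := ih (h ++ [(π h, feedback x (π h))])
      rw [pulls_append, if_neg he, add_zero] at this
      calc
        _ ≤ roundWeight w' x * (Real.exp (-(d * pulls e h)) *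
            G (h ++ [(π h, feedback x (π h))])) := by
          gcongr
          exact roundWeight_nonneg _ _
        _ = _ := by ring

theorem exp_neg_le_of_le_half {s : ℝ} (h0 : 0 ≤ s) (h1 : s ≤ 1 / 2) :
    Real.exp (-s) ≤ 1 - 3 / 4 * s := by
  have h := Real.quadratic_le_exp_of_nonneg h0
  have hp := Real.exp_pos s
  rw [Real.exp_neg, inv_le_iff_one_le_mul₀ hp]
  nlinarith [mul_nonneg h0 (sub_nonneg.2 h1), mul_nonneg h0 (mul_nonneg h0 (sub_nonneg.2 h1)),
    mul_le_mul_of_nonneg_left h (show 0 ≤ 1 - 3 / 4 * s by linarith)]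

/-- The expected number of rounds in which item `e` is listed. -/
def expectedPulls {L K : ℕ} (π : Policy L K) (w : Fin L → unitInterval) (n : ℕ) (e : Fin L) : ℝ :=
  ∫ ω, pulls e (history π ω n) ∂(law w)

theorem expectedPulls_nonneg {L K : ℕ} (π : Policy L K) (w : Fin L → unitInterval) (n : ℕ)
    (e : Fin L) : 0 ≤ expectedPulls π w n e :=
  integral_nonneg fun _ => pulls_nonneg _ _

/-- Linearizing both sides of the exponential inequality gives `1 - (c+d) E ≤ 1 - 3/4 c E'`. The
bound is multiplicative, so it can be summed over items directly. -/
theorem expectedPulls_le_mul {L K : ℕ} (π : Policy L K)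
    {w w' : Fin L → unitInterval} {e : Fin L} (hw : ∀ i, i ≠ e → w i = w' i)
    (h0 : 0 < (w e : ℝ)) (h1 : (w e : ℝ) < 1) (h0' : 0 < (w' e : ℝ)) (h1' : (w' e : ℝ) < 1)
    {n : ℕ} (hn : 0 < n) :
    expectedPulls π w' n e ≤
      4 / 3 * (1 + 2 * n * ((w' e - w e : ℝ) ^ 2 / (w' e * (1 - w' e)))) *
        expectedPulls π w n e := by
  have hn' : (0 : ℝ) < n := by exact_mod_cast hn
  -- At most `n` listings occur, so this keeps `c * pulls ≤ 1/2`, where `exp_neg_le_of_le_half`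
  -- applies.
  set c : ℝ := 1 / (2 * n) with hc
  have hc0 : 0 < c := by positivity
  have h := exp_neg_expectedStep_iterate_le π hw h0 h1 h0' h1' rfl c n []
  rw [← integral_history, ← integral_history, integral_const_mul] at h
  set d := (w' e - w e : ℝ) ^ 2 / (w' e * (1 - w' e)) with hd
  have h2 : ∫ ω, Real.exp (-(c * pulls e (history π ω n))) ∂(law w') ≤
      1 - 3 / 4 * (c * expectedPulls π w' n e) := by
    have : ∫ ω, (1 - 3 / 4 * (c * pulls e (history π ω n))) ∂(law w') =
        1 - 3 / 4 * (c * expectedPulls π w' n e) := by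
      rw [integral_sub (integrable_const _)
        (((integrable_history π w' (pulls e) n).const_mul c).const_mul _),
        integral_const_mul, integral_const_mul]
      simp [expectedPulls]
    rw [← this]
    refine integral_mono (integrable_history π w' (fun h => Real.exp (-(c * pulls e h))) n)
      (integrable_history π w' (fun h => 1 - 3 / 4 * (c * pulls e h)) n) fun ω => ?_
    refine exp_neg_le_of_le_half (mul_nonneg hc0.le (pulls_nonneg _ _)) ?_
    have hl := pulls_le_length e (history π ω n)
    rw [history_length] at hl
    calc c * pulls e (history π ω n) ≤ c * n := by gcongr
      _ = 1 / 2 := by rw [hc]; field_simp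
  have h3 := Real.one_sub_le_exp_neg ((c + d) * expectedPulls π w n e)
  simp only [pulls, List.map_nil, List.sum_nil, mul_zero, neg_zero, Real.exp_zero, one_mul] at h
  have h4 : 3 / 4 * (c * expectedPulls π w' n e) ≤ (c + d) * expectedPulls π w n e := by
    have := (h3.trans h).trans h2
    linarith
  have h5 : (1 + 2 * n * d) = 2 * n * (c + d) := by rw [hc]; field_simp
  have h6 : expectedPulls π w' n e = 2 * n * (c * expectedPulls π w' n e) := by
    rw [hc]; field_simp
  rw [h5]
  calc expectedPulls π w' n e = 4 / 3 * (2 * n) * (3 / 4 * (c * expectedPulls π w' n e)) := by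
        linarith
    _ ≤ 4 / 3 * (2 * n) * ((c + d) * expectedPulls π w n e) := by gcongr
    _ = _ := by ring

/-! ### Boundedness of the regret and existence of the minimum -/

theorem noClickProb_nonneg {L K : ℕ} (w : Fin L → unitInterval) (A : Action L K) :
    0 ≤ noClickProb w A :=
  Finset.prod_nonneg fun k _ => sub_nonneg.2 (w (A k)).2.2

theorem noClickProb_le_one {L K : ℕ} (w : Fin L → unitInterval) (A : Action L K) :
    noClickProb w A ≤ 1 :=
  Finset.prod_le_one (fun k _ => sub_nonneg.2 (w (A k)).2.2)
    fun k _ => sub_le_self _ (w (A k)).2.1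

theorem optNoClickProb_le {L K : ℕ} (w : Fin L → unitInterval) (A : Action L K) :
    optNoClickProb K w ≤ noClickProb w A :=
  ciInf_le (Set.finite_range _).bddBelow A

theorem optNoClickProb_nonneg {L : ℕ} (K : ℕ) (w : Fin L → unitInterval) :
    0 ≤ optNoClickProb K w :=
  Real.iInf_nonneg fun A => noClickProb_nonneg w A

theorem regret_le {L K : ℕ} (π : Policy L K) (w : Fin L → unitInterval) (n : ℕ) :
    regret π w n ≤ n := by
  refine (le_abs_self _).trans ?_
  have h : ∀ ω, ‖∑ t ∈ Finset.range n, (noClickProb w (action π ω t) - optNoClickProb K w)‖ ≤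
      (n : ℝ) := fun ω => by
    refine (norm_sum_le_of_le _ (f := fun t => noClickProb w (action π ω t) - optNoClickProb K w)
      (n := fun _ => 1) fun t _ => ?_).trans (by simp)
    rw [Real.norm_of_nonneg (sub_nonneg.2 (optNoClickProb_le _ _))]
    have := noClickProb_le_one w (action π ω t)
    have := optNoClickProb_nonneg K w
    linarith
  simpa [regret] using norm_integral_le_of_norm_le_const (μ := law w) (.of_forall h)

theorem regret_congr {L K : ℕ} {π π' : Policy L K} {n : ℕ}
    (h : ∀ l : History L K, l.length < n → π l = π' l) (w : Fin L → unitInterval) :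
    regret π w n = regret π' w n := by
  have hh : ∀ ω, ∀ t ≤ n, history π ω t = history π' ω t := fun ω t ht => by
    induction t with
    | zero => rfl
    | succ t ih =>
      have := ih (by omega)
      simp only [history, this]
      rw [h _ (by rw [history_length]; omega)]
  unfold regret
  congr 1
  ext ω
  refine Finset.sum_congr rfl fun t ht => ?_
  have ht := Finset.mem_range.1 ht
  rw [action, action, hh ω t ht.le, h _ (by rw [history_length]; omega)]

theorem isWorstCaseRegret_iSup {L K : ℕ} (π : Policy L K) (n : ℕ) :
    IsWorstCaseRegret π n (⨆ w, regret π w n) :=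
  isLUB_ciSup ⟨n, by rintro _ ⟨w, rfl⟩; exact regret_le π w n⟩

theorem finite_range_worstCaseRegret (L K n : ℕ) :
    (Set.range fun π : Policy L K => ⨆ w, regret π w n).Finite := by
  let T := {l : History L K // l.length < n}
  have : Finite T := List.finite_length_lt _ n
  let ρ : Policy L K → T → Action L K := fun π l => π l
  let Φ : Policy L K → ℝ := fun π => ⨆ w, regret π w n
  have hf : Function.FactorsThrough Φ ρ := fun π π' h => by
    have h' : ∀ l : History L K, l.length < n → π l = π' l := fun l hl =>
      congrFun h (⟨l, hl⟩ : T)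
    simp only [Φ, regret_congr h']
  -- Worst-case regret factors through the restriction to histories shorter than `n`; the default
  -- `0` is irrelevant.
  refine (Set.finite_range fun g => ρ.extend Φ 0 g).subset ?_
  rintro _ ⟨π, rfl⟩
  exact ⟨ρ π, hf.extend_apply _ π⟩

theorem exists_isMinimaxRegret {L K : ℕ} (hKL : K ≤ L) (n : ℕ) :
    ∃ π : Policy L K, IsMinimaxRegret L K n (⨆ w, regret π w n) := by
  have : Nonempty (Policy L K) := ⟨fun _ => Fin.castLEEmb hKL⟩
  obtain ⟨_, ⟨π, rfl⟩, hπ⟩ := Set.exists_min_image _ id (finite_range_worstCaseRegret L K n)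
    (Set.range_nonempty _)
  refine ⟨π, ⟨π, isWorstCaseRegret_iSup π n⟩, ?_⟩
  rintro s ⟨π', hs⟩
  rw [hs.unique (isWorstCaseRegret_iSup π' n)]
  exact hπ _ ⟨π', rfl⟩

/-! ### Two-level instances -/

/-- The instance with mean `q` on the items of `S` and mean `p` on all others. -/
def twoLevel {L : ℕ} (p q : unitInterval) (S : Finset (Fin L)) : Fin L → unitInterval :=
  fun e => if e ∈ S then q else p

/-- Replace the factors `b` by `a` one at a time; each swap loses at least `c * (b - a)`, the other
factors being at least `a`. -/
theorem mul_le_pow_mul_pow_sub_pow {a b c : ℝ} {K : ℕ} (ha : 0 ≤ a) (hab : a ≤ b)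
    (hc : ∀ j < K, c ≤ a ^ j) {m r : ℕ} (h : m + r ≤ K) :
    c * (b - a) * r ≤ a ^ m * b ^ r - a ^ (m + r) := by
  induction r generalizing m with
  | zero => simp
  | succ r ih =>
    have h1 := ih (m := m + 1) (by omega)
    have h2 : c * (b - a) ≤ a ^ m * b ^ r * (b - a) := by
      refine mul_le_mul_of_nonneg_right ((hc (m + r) (by omega)).trans ?_) (by linarith)
      rw [pow_add]
      gcongr
    rw [show m + (r + 1) = m + 1 + r by omega, pow_succ b]
    rw [pow_succ a m] at h1
    push_cast
    linarith

open Classical in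
theorem sum_mem_range {L K : ℕ} (A : Action L K) (S : Finset (Fin L)) :
    ∑ e ∈ S, (if e ∈ Set.range A then (1 : ℝ) else 0) = (Finset.univ.filter (A · ∈ S)).card := by
  rw [Finset.sum_boole, ← Finset.card_map A]
  congr 2
  ext e
  simp only [Finset.mem_filter, Set.mem_range, Finset.mem_map, Finset.mem_univ, true_and]
  constructor
  · rintro ⟨h, k, rfl⟩
    exact ⟨k, h, rfl⟩
  · rintro ⟨k, h, rfl⟩
    exact ⟨h, k, rfl⟩

open Classical in
theorem le_noClickProb_twoLevel_sub {L K : ℕ} {p q : unitInterval} (hpq : p ≤ q)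
    {S : Finset (Fin L)} (hS : S.card = K) {c : ℝ} (hc : ∀ j < K, c ≤ (1 - q : ℝ) ^ j)
    (A : Action L K) :
    c * (q - p) * (K - ∑ e ∈ S, if e ∈ Set.range A then (1 : ℝ) else 0) ≤
      noClickProb (twoLevel p q S) A - optNoClickProb K (twoLevel p q S) := by
  have hopt : optNoClickProb K (twoLevel p q S) ≤ (1 - q : ℝ) ^ K := by
    refine (optNoClickProb_le _ (S.orderEmbOfFin hS).toEmbedding).trans (le_of_eq ?_)
    simp [noClickProb, twoLevel]
  have hpq' : (p : ℝ) ≤ q := hpq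
  have hcard := Finset.card_filter_add_card_filter_not (s := (Finset.univ : Finset (Fin K)))
    (fun k => A k ∈ S)
  rw [Finset.card_univ, Fintype.card_fin] at hcard
  have hno : noClickProb (twoLevel p q S) A =
      (1 - q : ℝ) ^ (Finset.univ.filter (A · ∈ S)).card *
        (1 - p : ℝ) ^ (Finset.univ.filter (A · ∉ S)).card := by
    have : ∀ k, (1 - (twoLevel p q S (A k) : ℝ)) = if A k ∈ S then (1 - q : ℝ) else 1 - p :=
      fun k => by unfold twoLevel; split_ifs <;> rfl
    simp only [noClickProb, this, Finset.prod_ite, Finset.prod_const]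
  have hmain := mul_le_pow_mul_pow_sub_pow (b := (1 - p : ℝ)) (sub_nonneg.2 q.2.2)
    (by linarith) hc hcard.le
  rw [hcard, ← hno] at hmain
  have hr : ((Finset.univ.filter (A · ∉ S)).card : ℝ) =
      K - (Finset.univ.filter (A · ∈ S)).card := by
    have : ((Finset.univ.filter (A · ∈ S)).card : ℝ) + (Finset.univ.filter (A · ∉ S)).card = K := by
      exact_mod_cast hcard
    linarith
  rw [sum_mem_range, ← hr]
  refine le_trans (le_of_eq ?_) (hmain.trans (by linarith))
  ring

open Classical in
theorem pulls_history {L K : ℕ} (π : Policy L K) (ω : ℕ → Fin L → Bool) (e : Fin L) (n : ℕ) :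
    pulls e (history π ω n) =
      ∑ t ∈ Finset.range n, if e ∈ Set.range (action π ω t) then (1 : ℝ) else 0 := by
  induction n with
  | zero => simp [pulls, history]
  | succ n ih =>
    rw [Finset.sum_range_succ, ← ih, history, pulls_append]
    rfl

theorem sum_expectedPulls {L K : ℕ} (π : Policy L K) (w : Fin L → unitInterval) (n : ℕ) :
    ∑ e, expectedPulls π w n e = n * K := by
  classical
  simp only [expectedPulls]
  rw [← integral_finsetSum _ fun e _ => integrable_history π w (pulls e) n]
  have : ∀ ω, ∑ e, pulls e (history π ω n) = (n * K : ℝ) := fun ω => by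
    simp only [pulls_history]
    rw [Finset.sum_comm]
    simp only [sum_mem_range]
    simp
  simp [this]

theorem le_regret_twoLevel {L K : ℕ} (π : Policy L K) {p q : unitInterval} (hpq : p ≤ q)
    {S : Finset (Fin L)} (hS : S.card = K) {c : ℝ} (hc : ∀ j < K, c ≤ (1 - q : ℝ) ^ j) (n : ℕ) :
    c * (q - p) * (n * K - ∑ e ∈ S, expectedPulls π (twoLevel p q S) n e) ≤
      regret π (twoLevel p q S) n := by
  classical
  set w := twoLevel p q S with hw
  have hint : ∀ e, Integrable (fun ω => pulls e (history π ω n)) (law w) := fun e =>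
    integrable_history π w (pulls e) n
  have hl : ∫ ω, c * (q - p) * (n * K - ∑ e ∈ S, pulls e (history π ω n)) ∂(law w) =
      c * (q - p) * (n * K - ∑ e ∈ S, expectedPulls π w n e) := by
    rw [integral_const_mul, integral_sub (integrable_const _)
      (integrable_finsetSum _ fun e _ => hint e), integral_finsetSum _ fun e _ => hint e]
    simp [expectedPulls]
  rw [← hl, regret]
  refine integral_mono
    (((integrable_const _).sub (integrable_finsetSum _ fun e _ => hint e)).const_mul _)
    (integrable_finsetSum _ fun t _ => integrable_history π w
      (fun h => noClickProb w (π h) - optNoClickProb K w) t) fun ω => ?_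
  have h : c * (q - p) * (n * K - ∑ e ∈ S, pulls e (history π ω n)) =
      ∑ t ∈ Finset.range n, c * (q - p) *
        (K - ∑ e ∈ S, if e ∈ Set.range (action π ω t) then (1 : ℝ) else 0) := by
    simp only [pulls_history]
    rw [← Finset.mul_sum, Finset.sum_sub_distrib, Finset.sum_comm]
    simp
  simp only [h]
  exact Finset.sum_le_sum fun t _ => le_noClickProb_twoLevel_sub hpq hS hc _

/-! ### Averaging over the good sets -/

/-- Double counting: a set with a marked element is a smaller set with a marked outsider. -/
theorem sum_powersetCard_succ_erase {α : Type*} [Fintype α] [DecidableEq α] (k : ℕ)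
    (f : Finset α → α → ℝ) :
    ∑ S ∈ Finset.univ.powersetCard (k + 1), ∑ e ∈ S, f (S.erase e) e =
      ∑ S ∈ Finset.univ.powersetCard k, ∑ e ∈ Sᶜ, f S e := by
  rw [Finset.sum_sigma', Finset.sum_sigma']
  refine Finset.sum_bij' (fun x _ => ⟨x.1.erase x.2, x.2⟩) (fun x _ => ⟨insert x.2 x.1, x.2⟩)
    ?_ ?_ ?_ ?_ ?_
  · rintro ⟨S, e⟩ h
    simp only [Finset.mem_sigma, Finset.mem_powersetCard_univ, Finset.mem_compl] at h ⊢
    simp [Finset.card_erase_of_mem h.2, h.1]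
  · rintro ⟨S, e⟩ h
    simp only [Finset.mem_sigma, Finset.mem_powersetCard_univ, Finset.mem_compl] at h ⊢
    simp [Finset.card_insert_of_notMem h.2, h.1]
  · rintro ⟨S, e⟩ h
    simp only [Finset.mem_sigma] at h
    simp [Finset.insert_erase h.2]
  · rintro ⟨S, e⟩ h
    simp only [Finset.mem_sigma, Finset.mem_compl] at h
    simp [Finset.erase_insert h.2]
  · simp

/-- Averaging over all sets of `K` good items. -/
theorem exists_sum_expectedPulls_le {L K n : ℕ} (hK : 1 ≤ K) (hKL : K ≤ L) (hn : 0 < n)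
    (π : Policy L K) {p q : unitInterval}
    (hp0 : 0 < (p : ℝ)) (hp1 : (p : ℝ) < 1) (hq0 : 0 < (q : ℝ)) (hq1 : (q : ℝ) < 1) {b : ℝ}
    (hb : 4 / 3 * (1 + 2 * n * ((q - p : ℝ) ^ 2 / (q * (1 - q)))) * K ≤ b * (L - K + 1)) :
    ∃ S : Finset (Fin L), S.card = K ∧
      ∑ e ∈ S, expectedPulls π (twoLevel p q S) n e ≤ b * (n * K) := by
  obtain ⟨k, rfl⟩ : ∃ k, K = k + 1 := ⟨K - 1, by omega⟩
  set C : ℝ := 4 / 3 * (1 + 2 * n * ((q - p : ℝ) ^ 2 / (q * (1 - q)))) with hC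
  have hC0 : 0 ≤ C := by
    have := sub_pos.2 hq1
    positivity
  have hstep : ∀ S : Finset (Fin L), ∀ e ∈ S, expectedPulls π (twoLevel p q S) n e ≤
      C * expectedPulls π (twoLevel p q (S.erase e)) n e := fun S e he => by
    have hq : twoLevel p q S e = q := by simp [twoLevel, he]
    have hp : twoLevel p q (S.erase e) e = p := by simp [twoLevel]
    have := expectedPulls_le_mul π (w := twoLevel p q (S.erase e)) (w' := twoLevel p q S) (e := e)
      (fun i hi => by simp [twoLevel, hi]) (by rwa [hp]) (by rwa [hp]) (by rwa [hq])
      (by rwa [hq]) hn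
    rwa [hp, hq, ← hC] at this
  have hsum : ∑ S ∈ Finset.univ.powersetCard (k + 1), ∑ e ∈ S,
      expectedPulls π (twoLevel p q S) n e ≤ C * (L.choose k * (n * (k + 1 : ℕ))) := by
    calc _ ≤ ∑ S ∈ Finset.univ.powersetCard (k + 1), ∑ e ∈ S,
          C * expectedPulls π (twoLevel p q (S.erase e)) n e :=
        Finset.sum_le_sum fun S _ => Finset.sum_le_sum fun e he => hstep S e he
      _ = ∑ S ∈ Finset.univ.powersetCard k, ∑ e ∈ Sᶜ,
          C * expectedPulls π (twoLevel p q S) n e :=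
        sum_powersetCard_succ_erase k fun S e => C * expectedPulls π (twoLevel p q S) n e
      -- Extending the inner sum from `Sᶜ` to all items gives the total number of slots.
      _ ≤ ∑ S ∈ (Finset.univ : Finset (Fin L)).powersetCard k, C * (n * (k + 1 : ℕ)) := by
        refine Finset.sum_le_sum fun S _ => ?_
        rw [← Finset.mul_sum, ← sum_expectedPulls π (twoLevel p q S) n]
        gcongr
        · exact fun e _ _ => expectedPulls_nonneg _ _ _ _
        · exact Finset.subset_univ _
      _ = _ := by
        rw [Finset.sum_const, Finset.card_powersetCard, Finset.card_univ, Fintype.card_fin,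
          nsmul_eq_mul]
        ring
  have hchoose : (L.choose (k + 1) : ℝ) * (k + 1 : ℕ) = L.choose k * (L - (k + 1 : ℕ) + 1) := by
    have := Nat.choose_succ_right_eq L k
    have h' : ((L - k : ℕ) : ℝ) = L - (k + 1 : ℕ) + 1 := by
      rw [Nat.cast_sub (by omega)]; push_cast; ring
    rw [← h']
    exact_mod_cast this
  have hle : ∑ S ∈ Finset.univ.powersetCard (k + 1), ∑ e ∈ S,
      expectedPulls π (twoLevel p q S) n e ≤
        ∑ S ∈ (Finset.univ : Finset (Fin L)).powersetCard (k + 1), b * (n * (k + 1 : ℕ)) := by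
    refine hsum.trans ?_
    rw [Finset.sum_const, Finset.card_powersetCard, Finset.card_univ, Fintype.card_fin,
      nsmul_eq_mul]
    calc _ = L.choose k * n * (C * (k + 1 : ℕ)) := by ring
      _ ≤ L.choose k * n * (b * (L - (k + 1 : ℕ) + 1)) := by gcongr
      _ = b * n * (L.choose k * (L - (k + 1 : ℕ) + 1)) := by ring
      _ = _ := by rw [← hchoose]; ring
  obtain ⟨S, hS, h⟩ := Finset.exists_le_of_sum_le
    (Finset.powersetCard_nonempty.2 (by simpa using hKL)) hle
  exact ⟨S, Finset.mem_powersetCard_univ.1 hS, h⟩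

/-! ### Choice of parameters and conclusion -/

theorem exists_le_regret {L K N n : ℕ} (hK : 1 ≤ K) (hLK : L = N * K) (hN : 4 ≤ N) (hn : L ≤ n)
    (π : Policy L K) :
    ∃ w, (1 / 48 : ℝ) * Real.sqrt (n * L) ≤ regret π w n := by
  have hKL : K ≤ L := hLK ▸ Nat.le_mul_of_pos_left K (by omega)
  have hn0 : 0 < n := by omega
  have hK' : (1 : ℝ) ≤ K := by exact_mod_cast hK
  have hN' : (4 : ℝ) ≤ N := by exact_mod_cast hN
  have hn' : (0 : ℝ) < n := by exact_mod_cast hn0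
  have hL' : (L : ℝ) = N * K := by exact_mod_cast hLK
  have hLn : (L : ℝ) ≤ n := by exact_mod_cast hn
  set s : ℝ := Real.sqrt (L / n) with hs
  have hs0 : 0 ≤ s := Real.sqrt_nonneg _
  have hs2 : s ^ 2 = L / n := Real.sq_sqrt (by positivity)
  have hs1 : s ≤ 1 := Real.sqrt_le_one.2 ((div_le_one hn').2 hLn)
  set q : ℝ := 1 / (2 * K) with hq
  set δ : ℝ := s / (8 * K) with hδ
  have hq0 : 0 < q := by positivity
  have hq1 : q ≤ 1 / 2 := by
    rw [hq]
    gcongr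
    linarith
  have hδ0 : 0 ≤ δ := by positivity
  have hδq : δ < q := by
    rw [hδ, hq, div_lt_div_iff₀ (by positivity) (by positivity)]
    nlinarith
  let q' : unitInterval := ⟨q, hq0.le, by linarith⟩
  let p' : unitInterval := ⟨q - δ, by linarith, by linarith⟩
  have hd : 2 * n * (δ ^ 2 / (q * (1 - q))) ≤ (N : ℝ) / 8 := by
    have h1 : δ ^ 2 / (q * (1 - q)) ≤ δ ^ 2 / (q * (1 / 2)) := by
      gcongr
      linarith
    calc 2 * n * (δ ^ 2 / (q * (1 - q))) ≤ 2 * n * (δ ^ 2 / (q * (1 / 2))) := by gcongr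
      _ = (N : ℝ) / 8 := by
        rw [hδ, div_pow, hs2, hq, hL']
        field_simp
        norm_num
  -- With `2nd ≤ N/8`, the value `b = 2/3` needs `4/3 (1 + N/8) ≤ 2/3 (N - 1)`, which is exactly `N
  -- ≥ 4`.
  obtain ⟨S, hS, hb⟩ := exists_sum_expectedPulls_le (b := 2 / 3) hK hKL hn0 π (p := p') (q := q')
    (by simp only [p']; linarith) (by simp only [p']; linarith) hq0
    (by simp only [q']; linarith) (by
      simp only [p', q', sub_sub_cancel]
      rw [hL']
      have : 4 / 3 * (1 + 2 * n * (δ ^ 2 / (q * (1 - q)))) * (K : ℝ) ≤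
          4 / 3 * (1 + N / 8) * K := by gcongr
      nlinarith [mul_nonneg (sub_nonneg.2 hN') (by linarith : (0 : ℝ) ≤ K)])
  refine ⟨twoLevel p' q' S, ?_⟩
  -- Bernoulli's inequality with `K * q = 1/2`.
  have hc : ∀ j < K, (1 / 2 : ℝ) ≤ (1 - (q' : ℝ)) ^ j := fun j hj => by
    have h := one_add_mul_le_pow (a := -q) (by linarith) j
    have hjK : (j : ℝ) ≤ K := by exact_mod_cast hj.le
    have : (j : ℝ) * q ≤ K * q := by gcongr
    have hKq : (K : ℝ) * q = 1 / 2 := by rw [hq]; field_simp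
    rw [← sub_eq_add_neg] at h
    exact le_trans (by linarith) h
  refine le_trans ?_ (le_regret_twoLevel π (show p' ≤ q' from Subtype.mk_le_mk.2 (by linarith))
    hS hc n)
  have hsq : Real.sqrt (n * L) = n * s := by
    rw [hs, ← Real.sqrt_sq hn'.le, ← Real.sqrt_mul (by positivity), Real.sqrt_sq hn'.le]
    congr 1
    field_simp
  have hδK : δ * K = s / 8 := by rw [hδ]; field_simp
  simp only [p', q', sub_sub_cancel] at hb ⊢
  calc 1 / 48 * Real.sqrt (n * L) = 1 / 2 * δ * (n * K - 2 / 3 * (n * K)) := by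
        rw [hsq]
        linear_combination (-(n : ℝ) / 6) * hδK
    _ ≤ _ := by gcongr

end CascadingBandit

end

theorem theorem1 (L K N n : ℕ) (hK : 1 ≤ K) (hLK : L = N * K) (hN : 4 ≤ N) (hn : L ≤ n) :
    ∃ r : ℝ, CascadingBandit.IsMinimaxRegret L K n r ∧
      (1 / 160 : ℝ) * Real.sqrt ((n : ℝ) * (L : ℝ)) ≤ r := by
  obtain ⟨π, hπ⟩ := CascadingBandit.exists_isMinimaxRegret
    (hLK ▸ Nat.le_mul_of_pos_left K (by omega) : K ≤ L) n
  obtain ⟨w, hw⟩ := CascadingBandit.exists_le_regret hK hLK hN hn π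
  refine ⟨_, hπ, ?_⟩
  have h := (CascadingBandit.isWorstCaseRegret_iSup π n).1 ⟨w, rfl⟩
  have h0 := Real.sqrt_nonneg ((n : ℝ) * L)
  simp only at h
  linarith
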